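/- Write $\log x:=\ln(\max\{x,e\})$, let $[\cdot]$ denote the integer part, and let $a_n\ll b_n$ mean $a_n=O(b_n)$. Let $\{Y_n:n\ge 1\}$ be a sequence of independent real random variables on a probability space, and let $S_n=Y_1+\cdots+Y_n$. Let $(d_n)_{n\ge1}$ be a sequence of positive numbers such that, for some $\gamma>0$, some integer $n_0\ge 1$ and some constant $c>0$, \[ \frac{d_l}{d_k}\ge c\left(\frac lk\right)^{\gamma}\qquad (l\ge k\ge n_0). \] Suppose that, for some constants $\mu\in\mathbb R$, $\gamma'\in(0,\gamma)$ and $\varepsilon>0$, every $S_n$ is integrable and \[ \mathbb{E}\left|\frac{S_n-\mu n}{d_n}\right| \ll e^{\gamma'(\log n)^{1-\varepsilon}} . \] Then for any $t\in[0,1]$ and any probability distribution function $G_t$ on $\mathbb R$, the following two statements are equivalent: (i) for every continuity point $x$ of $G_t$, almost surely, \[ \frac 1{\log N}\sum_{n=1}^N \frac1n\, \mathbf {I}\biggl(\frac{1}{d_n}\sum_{k=1}^{[nt]}\Bigl(\frac{S_k}{k}-\mu\Bigr)\le x\biggr)\to G_t(x) \quad \text{as } N \to\infty; \] (ii) for every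 continuity point $x$ of $G_t$, \[ \frac 1{\log N}\sum_{n=1}^N \frac1n\, \mathbb{P}\biggl(\frac{1}{d_n}\sum_{k=1}^{[nt]}\Bigl(\frac{S_k}{k}-\mu\Bigr) \le x\biggr) \to G_t(x)\quad \text{as } N \to\infty . \] -/

import Mathlib

open MeasureTheory ProbabilityTheory Filter Topology Asymptotics

noncomputable section

/-- The logarithm `log x = ln (max {x, e})`, so that `log x ≥ 1` for all real `x`. -/
def logPlus (x : ℝ) : ℝ := Real.log (max x (Real.exp 1))

/-- The partial sums `S_n = Y_1 + ⋯ + Y_n` (the value `Y 0` is not used). -/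
def partialSum {Ω : Type*} (Y : ℕ → Ω → ℝ) (n : ℕ) (ω : Ω) : ℝ :=
  ∑ k ∈ Finset.Icc 1 n, Y k ω

/-- The normalized sums `(1 / d_n) ∑_{k ≤ [n t]} (S_k / k - m)`. -/
def normalizedSum {Ω : Type*} (Y : ℕ → Ω → ℝ) (d : ℕ → ℝ) (m t : ℝ) (n : ℕ) (ω : Ω) : ℝ :=
  (1 / d n) * ∑ k ∈ Finset.Icc 1 ⌊(n : ℝ) * t⌋₊, (partialSum Y k ω / (k : ℝ) - m)

/-- The logarithmic averages `(1 / log N) ∑_{n = 1}^N a_n / n`. -/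
def logAverage (a : ℕ → ℝ) (N : ℕ) : ℝ :=
  (1 / logPlus N) * ∑ n ∈ Finset.Icc 1 N, (1 / (n : ℝ)) * a n

end

/-! Write X_n for the normalized sum. It suffices that, for each ramp φ (a bounded Lipschitz
function lying between two indicators), the logarithmic average of φ(X_n) - E φ(X_n) tends to 0
almost surely. Either statement then yields the other by squeezing between nearby continuity points
of G (`ae_tendsto_logAverage_iff`).

The concentration rests on covariance decay. For k ≤ l, deleting Y_1, …, Y_k from X_l leaves
`remainderSum`, which is independent of X_k. The deleted part has mean absolute value of order
(k/l)^γ exp(γ' L^(1-ε)) L with L = log N, N ≥ l, by the growth of d and the moment bound; so has the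
covariance (`exists_abs_covariance_le`).

If log(l/k) exceeds a multiple of L^(1-ε), this is O(L^(-ε)). The remaining pairs form a band around
the diagonal of total logarithmic weight O(L^(2-ε)). Hence the average has second moment O(L^(-ε))
(`exists_integral_sq_logAverage_le`), which is summable along N = ⌈exp(i^p)⌉ for p large; between
consecutive such N the weights add too little to matter (`ae_tendsto_logAverage_zero`). -/

/-! ### Logarithmic sums, growth of `d`, an exponential estimate -/

theorem one_le_logPlus (x : ℝ) : 1 ≤ logPlus x := by
  rw [logPlus, Real.le_log_iff_exp_le (lt_max_of_lt_right (Real.exp_pos 1))]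
  exact le_max_right _ _

theorem logPlus_pos (x : ℝ) : 0 < logPlus x := zero_lt_one.trans_le (one_le_logPlus x)

theorem log_le_logPlus {x : ℝ} (hx : 0 < x) : Real.log x ≤ logPlus x :=
  Real.log_le_log hx (le_max_left _ _)

theorem logPlus_mono : Monotone logPlus := fun _ _ h =>
  Real.log_le_log (lt_max_of_lt_right (Real.exp_pos 1)) (max_le_max_right _ h)

/-- Each term 1/(q+1) is at most log((q+1)/q), so the sum telescopes; the extra 1 pays for the first
term 1/p. -/
theorem sum_Icc_one_div_le {p q : ℕ} (hp : 1 ≤ p) (hpq : p ≤ q) :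
    ∑ k ∈ Finset.Icc p q, 1 / (k : ℝ) ≤ 1 + (Real.log q - Real.log p) := by
  induction q, hpq using Nat.le_induction with
  | base =>
    have : (1 : ℝ) ≤ p := by exact_mod_cast hp
    simpa using inv_le_one_of_one_le₀ this
  | succ q hq ih =>
    rw [← Finset.insert_Icc_right_eq_Icc_add_one (by omega), Finset.sum_insert (by simp)]
    have hq0 : (0 : ℝ) < q := by exact_mod_cast (by omega : 0 < q)
    have h := Real.one_sub_inv_le_log_of_pos (x := ((q : ℝ) + 1) / q) (by positivity)
    rw [Real.log_div (by positivity) (by positivity)] at h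
    have h2 : 1 - (((q : ℝ) + 1) / q)⁻¹ = 1 / ((q : ℝ) + 1) := by field_simp; ring
    push_cast
    linarith

/-- Measures the weight of the band |log k - log l| ≤ R for fixed l. -/
theorem sum_one_div_le_of_log_mem_Icc {s : Finset ℕ} {a b : ℝ} (hab : a ≤ b)
    (hs : ∀ k ∈ s, 1 ≤ k ∧ Real.log k ∈ Set.Icc a b) :
    ∑ k ∈ s, 1 / (k : ℝ) ≤ 1 + (b - a) := by
  rcases s.eq_empty_or_nonempty with rfl | hne
  · simp; linarith
  · have hmin := hs _ (s.min'_mem hne)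
    have hmax := hs _ (s.max'_mem hne)
    calc ∑ k ∈ s, 1 / (k : ℝ) ≤ ∑ k ∈ Finset.Icc (s.min' hne) (s.max' hne), 1 / (k : ℝ) := by
          refine Finset.sum_le_sum_of_subset_of_nonneg (fun k hk => ?_)
            (fun _ _ _ => by positivity)
          exact Finset.mem_Icc.2 ⟨s.min'_le k hk, s.le_max' k hk⟩
      _ ≤ 1 + (Real.log (s.max' hne) - Real.log (s.min' hne)) :=
          sum_Icc_one_div_le hmin.1 (s.min'_le_max' hne)
      _ ≤ 1 + (b - a) := by linarith [hmin.2.1, hmax.2.2]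

theorem sum_one_div_le_two_mul_logPlus (N : ℕ) :
    ∑ k ∈ Finset.Icc 1 N, 1 / (k : ℝ) ≤ 2 * logPlus N := by
  rcases Nat.eq_zero_or_pos N with rfl | hN
  · simpa using (logPlus_pos 0).le
  · have := sum_Icc_one_div_le le_rfl hN
    have h2 := log_le_logPlus (x := N) (by exact_mod_cast hN)
    have h3 := one_le_logPlus N
    simp only [Nat.cast_one, Real.log_one] at this
    linarith

theorem logAverage_mono {a b : ℕ → ℝ} (h : ∀ n, 1 ≤ n → a n ≤ b n) (N : ℕ) :
    logAverage a N ≤ logAverage b N := by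
  have := logPlus_pos N
  refine mul_le_mul_of_nonneg_left (Finset.sum_le_sum fun n hn => ?_) (by positivity)
  exact mul_le_mul_of_nonneg_left (h n (Finset.mem_Icc.1 hn).1) (by positivity)

theorem logAverage_sub (a b : ℕ → ℝ) (N : ℕ) :
    logAverage (fun n => a n - b n) N = logAverage a N - logAverage b N := by
  simp only [logAverage, mul_sub, Finset.sum_sub_distrib]

/-- A double logarithmic sum of a kernel bounded by `1` and by `δ` away from the diagonal. -/
theorem sum_sum_le_of_offDiagonal {r : ℕ → ℕ → ℝ} {N : ℕ} {R δ : ℝ} (hR : 0 ≤ R) (hδ : 0 ≤ δ)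
    (h1 : ∀ k ∈ Finset.Icc 1 N, ∀ l ∈ Finset.Icc 1 N, r k l ≤ 1)
    (h2 : ∀ k ∈ Finset.Icc 1 N, ∀ l ∈ Finset.Icc 1 N, R < |Real.log k - Real.log l| → r k l ≤ δ) :
    ∑ l ∈ Finset.Icc 1 N, ∑ k ∈ Finset.Icc 1 N, 1 / (l : ℝ) * (1 / (k : ℝ)) * r k l
      ≤ 2 * logPlus N * (1 + 2 * R) + δ * (2 * logPlus N) ^ 2 := by
  classical
  have hH := sum_one_div_le_two_mul_logPlus N
  have hL := logPlus_pos N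
  have inner : ∀ l ∈ Finset.Icc 1 N, ∑ k ∈ Finset.Icc 1 N, 1 / (l : ℝ) * (1 / (k : ℝ)) * r k l
      ≤ 1 / (l : ℝ) * ((1 + 2 * R) + δ * (2 * logPlus N)) := by
    intro l hl
    simp only [mul_assoc]
    rw [← Finset.mul_sum]
    refine mul_le_mul_of_nonneg_left ?_ (by positivity)
    have key : ∀ k ∈ Finset.Icc 1 N, 1 / (k : ℝ) * r k l ≤
        (if |Real.log k - Real.log l| ≤ R then 1 / (k : ℝ) else 0) + δ * (1 / (k : ℝ)) := by
      intro k hk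
      have hk0 : 0 ≤ 1 / (k : ℝ) := by positivity
      split_ifs with h
      · have := mul_le_mul_of_nonneg_left (h1 k hk l hl) hk0
        have := mul_nonneg hδ hk0
        linarith
      · have := mul_le_mul_of_nonneg_left (h2 k hk l hl (not_le.1 h)) hk0
        linarith
    refine (Finset.sum_le_sum key).trans ?_
    rw [Finset.sum_add_distrib, ← Finset.mul_sum, ← Finset.sum_filter]
    refine add_le_add ?_ (mul_le_mul_of_nonneg_left hH hδ)
    have := sum_one_div_le_of_log_mem_Icc
      (s := (Finset.Icc 1 N).filter fun k : ℕ => |Real.log k - Real.log l| ≤ R)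
      (a := Real.log l - R) (b := Real.log l + R) (by linarith) (by
        intro k hk
        rw [Finset.mem_filter, Finset.mem_Icc, abs_le] at hk
        exact ⟨hk.1.1, by linarith [hk.2.1], by linarith [hk.2.2]⟩)
    linarith
  refine (Finset.sum_le_sum inner).trans ?_
  rw [← Finset.sum_mul]
  refine (mul_le_mul_of_nonneg_right hH (by positivity)).trans (le_of_eq ?_)
  ring

/-- A lower power growth bound valid from some index on holds from `1` on, with another constant. -/
theorem exists_growth_from_one {d : ℕ → ℝ} (hd : ∀ n, 1 ≤ n → 0 < d n) {γ : ℝ} {n₀ : ℕ}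
    (hn₀ : 1 ≤ n₀)
    (h : ∃ C : ℝ, 0 < C ∧ ∀ k l : ℕ, n₀ ≤ k → k ≤ l → d k / d l ≤ C * ((k : ℝ) / l) ^ γ) :
    ∃ C : ℝ, 0 < C ∧ ∀ k l : ℕ, 1 ≤ k → k ≤ l → d k / d l ≤ C * ((k : ℝ) / l) ^ γ := by
  induction n₀, hn₀ using Nat.le_induction with
  | base => exact h
  | succ n hn ih =>
    obtain ⟨C, hC, h⟩ := h
    have hn0 : (0 : ℝ) < n := by exact_mod_cast hn
    have hdn := hd n hn
    have hdn' := hd (n + 1) (by omega)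
    set D : ℝ := d n / d (n + 1) * (C * (((n + 1 : ℕ) : ℝ) / n) ^ γ) with hD
    have hD0 : 0 < D := by positivity
    -- The three constants cover k > n, k = l = n, and k = n < l; the last case passes through index
    -- n + 1.
    refine ih ⟨max (max C 1) D, by positivity, fun k l hk hkl => ?_⟩
    have hk0 : (0 : ℝ) < k := by exact_mod_cast (by omega : 0 < k)
    have hl0 : (0 : ℝ) < l := by exact_mod_cast (by omega : 0 < l)
    rcases hk.eq_or_lt with rfl | hk
    · rcases hkl.eq_or_lt with rfl | hkl
      · rw [div_self hdn.ne', div_self hk0.ne', Real.one_rpow, mul_one]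
        exact (le_max_right C 1).trans (le_max_left _ _)
      · have hdl := hd l (by omega)
        have h3 := h (n + 1) l le_rfl hkl
        calc d n / d l = d n / d (n + 1) * (d (n + 1) / d l) := by field_simp
          _ ≤ d n / d (n + 1) * (C * (((n + 1 : ℕ) : ℝ) / l) ^ γ) := by gcongr
          _ = D * ((n : ℝ) / l) ^ γ := by
            have e : ((n + 1 : ℕ) : ℝ) / l = ((n + 1 : ℕ) : ℝ) / n * ((n : ℝ) / l) := by
              field_simp
            rw [e, Real.mul_rpow (by positivity) (by positivity), hD]
            ring
          _ ≤ _ := by gcongr; exact le_max_right _ _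
    · refine (h k l hk hkl).trans ?_
      gcongr
      exact (le_max_left C 1).trans (le_max_left _ _)

/-- Uses exp x ≥ x^4/24 at x = L^(1-ε); the fourth power suffices because 4(1-ε) ≥ 1+ε when ε ≤ 1/2.
-/
theorem exp_neg_rpow_mul_le {ε L : ℝ} (hε : ε ≤ 1 / 2) (hL : 1 ≤ L) :
    Real.exp (-L ^ (1 - ε)) * L ≤ 24 * L ^ (-ε) := by
  have hL0 : 0 < L := by linarith
  have h := Real.pow_div_factorial_le_exp (L ^ (1 - ε)) (by positivity) 4
  have h4 : L ^ (1 + ε) ≤ (L ^ (1 - ε)) ^ 4 := by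
    rw [← Real.rpow_natCast, ← Real.rpow_mul hL0.le]
    exact Real.rpow_le_rpow_of_exponent_le hL (by norm_num; linarith)
  have h5 : L ^ (1 + ε) ≤ 24 * Real.exp (L ^ (1 - ε)) := by
    norm_num [Nat.factorial] at h
    linarith
  have e : L = L ^ (1 + ε) * L ^ (-ε) := by
    rw [← Real.rpow_add hL0]; simp
  have hpos : 0 < L ^ (-ε) := by positivity
  calc Real.exp (-L ^ (1 - ε)) * L = Real.exp (-L ^ (1 - ε)) * L ^ (1 + ε) * L ^ (-ε) := by
        rw [mul_assoc, ← e]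
    _ ≤ Real.exp (-L ^ (1 - ε)) * (24 * Real.exp (L ^ (1 - ε))) * L ^ (-ε) := by gcongr
    _ = 24 * (Real.exp (-L ^ (1 - ε)) * Real.exp (L ^ (1 - ε))) * L ^ (-ε) := by ring
    _ = 24 * L ^ (-ε) := by rw [← Real.exp_add]; simp

/-! ### Passing from a sparse subsequence to all indices -/

/-- Interpolation along a subsequence `s` with `log (s (i + 1) / s i)` small compared to
`L (s i)`, for `W` varying at most logarithmically. -/
theorem tendsto_div_zero_of_subseq {W L : ℕ → ℝ} (hL : Monotone L) (hL1 : ∀ N, 0 < L N)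
    (hW : ∀ M N, 1 ≤ M → M ≤ N → |W N - W M| ≤ 1 + (Real.log N - Real.log M))
    {s : ℕ → ℕ} (hs : Tendsto s atTop atTop) {c : ℕ → ℝ}
    (hc : ∀ i, 1 ≤ i → 1 ≤ s i ∧ 1 + (Real.log (s (i + 1)) - Real.log (s i)) ≤ c i)
    (hcL : Tendsto (fun i => c i / L (s i)) atTop (𝓝 0))
    (hsub : Tendsto (fun i => W (s i) / L (s i)) atTop (𝓝 0)) :
    Tendsto (fun N => W N / L N) atTop (𝓝 0) := by
  rw [Metric.tendsto_atTop]
  intro η hη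
  have hsum : Tendsto (fun i => |W (s i) / L (s i)| + c i / L (s i)) atTop (𝓝 0) := by
    simpa using hsub.abs.add hcL
  obtain ⟨I, hI⟩ := eventually_atTop.1
    ((hsum.eventually_lt_const hη).and (eventually_ge_atTop 1))
  refine ⟨s I, fun N hN => ?_⟩
  have hex : ∃ j, N < s (I + j) := by
    obtain ⟨j, hj⟩ := eventually_atTop.1 (hs.eventually_gt_atTop N)
    exact ⟨j, hj _ (by omega)⟩
  classical
  -- Since `s` need not be monotone, i + 1 is taken as the first index beyond I at which `s` exceeds
  -- N.
  obtain ⟨i, hi, h1, h2⟩ : ∃ i, I ≤ i ∧ s i ≤ N ∧ N < s (i + 1) := by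
    have h0 : Nat.find hex ≠ 0 := fun h => by
      have := Nat.find_spec hex
      rw [h] at this
      simp at this
      omega
    obtain ⟨q, hq⟩ := Nat.exists_eq_succ_of_ne_zero h0
    refine ⟨I + q, by omega, not_lt.1 (Nat.find_min hex (by omega)), ?_⟩
    have := Nat.find_spec hex
    rwa [hq] at this
  obtain ⟨hlt, hi1⟩ := hI i hi
  obtain ⟨hs1, hci⟩ := hc i hi1
  have hN0 : (0 : ℝ) < N := by exact_mod_cast (by omega : 0 < N)
  have hlog : Real.log N ≤ Real.log (s (i + 1)) :=
    Real.log_le_log hN0 (by exact_mod_cast h2.le)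
  have hWN : |W N| ≤ |W (s i)| + c i := by
    have := hW (s i) N hs1 h1
    have h3 := abs_sub_abs_le_abs_sub (W N) (W (s i))
    linarith
  have hLi := hL1 (s i)
  rw [Real.dist_eq, sub_zero, abs_div, abs_of_pos (hL1 N)]
  calc |W N| / L N ≤ (|W (s i)| + c i) / L (s i) :=
        div_le_div₀ ((abs_nonneg _).trans hWN) hWN hLi (hL h1)
    _ = |W (s i) / L (s i)| + c i / L (s i) := by rw [abs_div, abs_of_pos hLi]; ring
    _ < η := hlt

/-- The subsequence `⌈exp (i ^ p)⌉`. -/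
theorem logPlus_ceil_exp_bounds {p i : ℕ} (hi : 1 ≤ i) :
    1 ≤ ⌈Real.exp ((i : ℝ) ^ p)⌉₊ ∧ (i : ℝ) ^ p ≤ Real.log ⌈Real.exp ((i : ℝ) ^ p)⌉₊ ∧
      Real.log ⌈Real.exp ((i : ℝ) ^ p)⌉₊ ≤ (i : ℝ) ^ p + 1 := by
  have h1 : 1 ≤ Real.exp ((i : ℝ) ^ p) := Real.one_le_exp (by positivity)
  have hle := Nat.le_ceil (Real.exp ((i : ℝ) ^ p))
  have hlt := Nat.ceil_lt_add_one (Real.exp_pos ((i : ℝ) ^ p)).le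
  have hpos : (0 : ℝ) < ⌈Real.exp ((i : ℝ) ^ p)⌉₊ := by linarith
  refine ⟨by exact_mod_cast hpos, (Real.le_log_iff_exp_le hpos).2 hle, ?_⟩
  rw [Real.log_le_iff_le_exp hpos, Real.exp_add]
  -- Rounding up at most doubles exp(i^p), as exp(i^p) ≥ 1, and 2 ≤ e.
  have : 2 ≤ Real.exp 1 := by linarith [Real.add_one_le_exp 1]
  nlinarith

theorem tendsto_succ_pow_sub_div (p : ℕ) :
    Tendsto (fun i : ℕ => (2 + (((i + 1 : ℕ) : ℝ) ^ (p + 1) - (i : ℝ) ^ (p + 1))) /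
      (i : ℝ) ^ (p + 1)) atTop (𝓝 0) := by
  have h1 : Tendsto (fun i : ℕ => 1 / (i : ℝ)) atTop (𝓝 0) := tendsto_one_div_atTop_nhds_zero_nat
  have h2 : Tendsto (fun i : ℕ => 2 * (1 / (i : ℝ)) ^ (p + 1) + ((1 + 1 / (i : ℝ)) ^ (p + 1) - 1))
      atTop (𝓝 0) := by
    have := ((h1.pow (p + 1)).const_mul 2).add (((h1.const_add 1).pow (p + 1)).sub_const 1)
    simpa using this
  refine h2.congr' ?_
  filter_upwards [eventually_gt_atTop 0] with i hi
  have hi0 : (i : ℝ) ≠ 0 := by exact_mod_cast hi.ne'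
  have : 1 + 1 / (i : ℝ) = ((i + 1 : ℕ) : ℝ) / i := by push_cast; field_simp
  rw [this, div_pow, div_pow]
  field_simp
  rw [one_pow, mul_one]

/-! ### Removing the first k summands, and independence -/

/-- The normalized sum of index `l` with the contribution of `Y_1, …, Y_k` removed. -/
noncomputable def remainderSum {Ω : Type*} (Y : ℕ → Ω → ℝ) (d : ℕ → ℝ) (m t : ℝ) (k l : ℕ)
    (ω : Ω) : ℝ :=
  (1 / d l) * ∑ j ∈ Finset.Icc 1 ⌊(l : ℝ) * t⌋₊,
    (partialSum Y j ω - partialSum Y (min j k) ω - m * ((j : ℝ) - (min j k : ℕ))) / (j : ℝ)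

/-- The j-th terms differ exactly by the centred sum of index min(j, k) over j. Extending the range
from [lt] to l removes t from the bound. -/
theorem abs_normalizedSum_sub_remainderSum_le {Ω : Type*} (Y : ℕ → Ω → ℝ) {d : ℕ → ℝ} (m : ℝ)
    {t : ℝ} (ht : t ≤ 1) (k : ℕ) {l : ℕ} (hd : 0 < d l) (ω : Ω) :
    |normalizedSum Y d m t l ω - remainderSum Y d m t k l ω| ≤
      (1 / d l) * ∑ j ∈ Finset.Icc 1 l,
        |partialSum Y (min j k) ω - m * (min j k : ℕ)| * (1 / (j : ℝ)) := by
  have hfloor : ⌊(l : ℝ) * t⌋₊ ≤ l :=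
    Nat.floor_le_of_le (mul_le_of_le_one_right (Nat.cast_nonneg l) ht)
  rw [normalizedSum, remainderSum, ← mul_sub, abs_mul, abs_of_pos (one_div_pos.2 hd),
    ← Finset.sum_sub_distrib]
  refine mul_le_mul_of_nonneg_left ?_ (one_div_pos.2 hd).le
  refine (Finset.abs_sum_le_sum_abs _ _).trans ?_
  refine (Finset.sum_le_sum fun j hj => le_of_eq ?_).trans
    (Finset.sum_le_sum_of_subset_of_nonneg (Finset.Icc_subset_Icc_right hfloor)
      fun _ _ _ => by positivity)
  have hj0 : (0 : ℝ) < j := by exact_mod_cast (Finset.mem_Icc.1 hj).1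
  rw [← abs_of_pos (one_div_pos.2 hj0), ← abs_mul]
  congr 1
  field_simp
  ring

/-- As g is centred and independent of V, both V and the constant E U integrate to 0 against g; only
U - V contributes. -/
theorem abs_integral_mul_le_of_indepFun {Ω : Type*} [MeasurableSpace Ω] {P : Measure Ω}
    [IsProbabilityMeasure P] {g U V D : Ω → ℝ} {K : ℝ} (hg : Measurable g) (hU : Measurable U)
    (hV : Measurable V) (hg1 : ∀ ω, |g ω| ≤ 1) (hU1 : ∀ ω, |U ω| ≤ 1) (hV1 : ∀ ω, |V ω| ≤ 1)
    (hg0 : ∫ ω, g ω ∂P = 0) (hind : IndepFun g V P)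
    (hUV : ∀ ω, |U ω - V ω| ≤ K * D ω) (hD : Integrable D P) :
    |∫ ω, g ω * (U ω - ∫ ω', U ω' ∂P) ∂P| ≤ K * ∫ ω, D ω ∂P := by
  have bdd : ∀ {f : Ω → ℝ}, Measurable f → (∀ ω, |f ω| ≤ 1) → Integrable f P := fun hf h =>
    Integrable.of_bound hf.aestronglyMeasurable 1 (Eventually.of_forall h)
  have hgU : Integrable (fun ω => g ω * U ω) P := bdd (hg.mul hU) fun ω => by
    rw [abs_mul]; exact mul_le_one₀ (hg1 ω) (abs_nonneg _) (hU1 ω)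
  have hgV : Integrable (fun ω => g ω * V ω) P := bdd (hg.mul hV) fun ω => by
    rw [abs_mul]; exact mul_le_one₀ (hg1 ω) (abs_nonneg _) (hV1 ω)
  have hgV0 : ∫ ω, g ω * V ω ∂P = 0 := by
    rw [hind.integral_fun_mul_eq_mul_integral hg.aestronglyMeasurable hV.aestronglyMeasurable,
      hg0, zero_mul]
  have e : ∫ ω, g ω * (U ω - ∫ ω', U ω' ∂P) ∂P = ∫ ω, g ω * (U ω - V ω) ∂P := by
    simp only [mul_sub]
    rw [integral_sub hgU ((bdd hg hg1).mul_const _), integral_sub hgU hgV, hgV0,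
      integral_mul_const, hg0, zero_mul]
  rw [e, ← integral_const_mul]
  refine (abs_integral_le_integral_abs).trans (integral_mono_of_nonneg
    (Eventually.of_forall fun ω => abs_nonneg _) (hD.const_mul K) (Eventually.of_forall fun ω => ?_))
  change |g ω * (U ω - V ω)| ≤ K * D ω
  rw [abs_mul]
  exact (mul_le_of_le_one_left (abs_nonneg _) (hg1 ω)).trans (hUV ω)

section Indep

variable {Ω : Type*} {Y : ℕ → Ω → ℝ} {d : ℕ → ℝ} {m t : ℝ}

/-- The σ-algebra is left free and only the summands involved need be measurable, so that this and
the next lemmas apply to σ-algebras generated by a block of the Y's. -/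
theorem measurable_partialSum_sub {mΩ : MeasurableSpace Ω} {i j : ℕ} (hij : i ≤ j)
    (h : ∀ n, i + 1 ≤ n → n ≤ j → Measurable (Y n)) :
    Measurable fun ω => partialSum Y j ω - partialSum Y i ω := by
  have e : (fun ω => partialSum Y j ω - partialSum Y i ω) =
      fun ω => ∑ n ∈ Finset.Icc (i + 1) j, Y n ω := by
    ext ω
    rw [partialSum, partialSum, sub_eq_iff_eq_add]
    have : Finset.Icc 1 j = Finset.Icc (i + 1) j ∪ Finset.Icc 1 i := by
      ext; simp only [Finset.mem_union, Finset.mem_Icc]; omega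
    rw [this, Finset.sum_union]
    refine Finset.disjoint_left.2 fun n hn hn' => ?_
    rw [Finset.mem_Icc] at hn hn'
    omega
  rw [e]
  refine Finset.measurable_fun_sum _ fun n hn => ?_
  rw [Finset.mem_Icc] at hn
  exact h n hn.1 hn.2

theorem measurable_partialSum {mΩ : MeasurableSpace Ω} {j : ℕ}
    (h : ∀ n, 1 ≤ n → n ≤ j → Measurable (Y n)) : Measurable (partialSum Y j) := by
  have := measurable_partialSum_sub (Nat.zero_le j) (by simpa using h)
  have e : partialSum Y j = fun ω => partialSum Y j ω - partialSum Y 0 ω := by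
    ext ω; simp [partialSum]
  rwa [e]

theorem measurable_normalizedSum {mΩ : MeasurableSpace Ω} {k : ℕ} (ht : t ≤ 1)
    (h : ∀ n, 1 ≤ n → n ≤ k → Measurable (Y n)) : Measurable (normalizedSum Y d m t k) := by
  have hfloor : ⌊(k : ℝ) * t⌋₊ ≤ k :=
    Nat.floor_le_of_le (mul_le_of_le_one_right (Nat.cast_nonneg k) ht)
  refine (Finset.measurable_fun_sum _ fun j hj => ?_).const_mul _
  rw [Finset.mem_Icc] at hj
  exact ((measurable_partialSum fun n h1 h2 => h n h1 (by omega)).div_const _).sub_const _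

theorem measurable_remainderSum {mΩ : MeasurableSpace Ω} {k l : ℕ}
    (h : ∀ n, k + 1 ≤ n → Measurable (Y n)) : Measurable (remainderSum Y d m t k l) := by
  refine (Finset.measurable_fun_sum _ fun j _ => ?_).const_mul _
  refine ((measurable_partialSum_sub (min_le_left j k) fun n h1 h2 => h n ?_).sub_const _).div_const _
  omega

theorem indepFun_normalizedSum_remainderSum [MeasurableSpace Ω] {P : Measure Ω}
    (hY_meas : ∀ n : ℕ, 1 ≤ n → Measurable (Y n))
    (hY_indep : iIndepFun (fun n : ℕ => Y (n + 1)) P) (ht : t ≤ 1) (k l : ℕ) :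
    IndepFun (normalizedSum Y d m t k) (remainderSum Y d m t k l) P := by
  -- With the shift n ↦ Y (n + 1), these index sets stand for Y_1, …, Y_k and Y_(k+1), Y_(k+2), ….
  have hdisj : Disjoint {i : ℕ | i < k} {i : ℕ | k ≤ i} :=
    Set.disjoint_left.2 fun i (h : i < k) (h' : k ≤ i) => not_le.2 h h'
  have hind := indep_iSup_of_disjoint
    (m := fun n : ℕ => MeasurableSpace.comap (Y (n + 1)) inferInstance)
    (fun n => (hY_meas (n + 1) (by omega)).comap_le) hY_indep hdisj
  rw [IndepFun_iff_Indep]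
  refine indep_of_indep_of_le_left (indep_of_indep_of_le_right hind ?_) ?_
  · refine Measurable.comap_le ?_
    refine measurable_remainderSum fun n hn => ?_
    obtain ⟨q, rfl⟩ : ∃ q, n = q + 1 := ⟨n - 1, by omega⟩
    exact (comap_measurable (Y (q + 1))).mono
      (le_iSup₂_of_le q (show k ≤ q by omega) le_rfl) le_rfl
  · refine Measurable.comap_le ?_
    refine measurable_normalizedSum ht fun n hn hn' => ?_
    obtain ⟨q, rfl⟩ : ∃ q, n = q + 1 := ⟨n - 1, by omega⟩
    exact (comap_measurable (Y (q + 1))).mono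
      (le_iSup₂_of_le q (show q < k by omega) le_rfl) le_rfl

end Indep

/-! ### Mean size of the removed contribution -/

section Covariance

variable {Ω : Type*} [MeasurableSpace Ω] {P : Measure Ω}
  {Y : ℕ → Ω → ℝ} {d : ℕ → ℝ} {γ m γ' ε t : ℝ}

/-- Moment bounds for all centred partial sums up to index `k` in terms of `d k`. -/
theorem exists_integral_abs_partialSum_le (hd_pos : ∀ n : ℕ, 1 ≤ n → 0 < d n) (hγ : 0 < γ)
    {C : ℝ} (hC : 0 < C)
    (hgrow : ∀ k l : ℕ, 1 ≤ k → k ≤ l → d k / d l ≤ C * ((k : ℝ) / l) ^ γ)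
    (hγ' : 0 < γ') (hε : ε ≤ 1)
    (hS_bound : (fun n : ℕ => ∫ ω, |(partialSum Y n ω - m * (n : ℝ)) / d n| ∂P)
      =O[atTop] (fun n : ℕ => Real.exp (γ' * logPlus n ^ (1 - ε)))) :
    ∃ M : ℝ, 0 < M ∧ ∀ i k : ℕ, 1 ≤ i → i ≤ k →
      ∫ ω, |partialSum Y i ω - m * (i : ℝ)| ∂P ≤
        M * (d k * Real.exp (γ' * logPlus k ^ (1 - ε))) := by
  -- The comparison function never vanishes, so one constant serves all indices.
  obtain ⟨M, hM, h⟩ := bound_of_isBigO_nat_atTop hS_bound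
  refine ⟨M * C, by positivity, fun i k hi hik => ?_⟩
  have hdi := hd_pos i hi
  have hdk := hd_pos k (hi.trans hik)
  have hi0 : (0 : ℝ) < i := by exact_mod_cast hi
  have hik' : (i : ℝ) ≤ k := by exact_mod_cast hik
  have h1 := (le_abs_self _).trans (h (x := i) (Real.exp_pos _).ne')
  simp only [abs_div, integral_div, abs_of_pos hdi, Real.norm_eq_abs, Real.abs_exp] at h1
  rw [div_le_iff₀ hdi] at h1
  have h2 : d i ≤ C * d k := by
    have := hgrow i k hi hik
    rw [div_le_iff₀ hdk] at this
    refine this.trans ?_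
    have h3 : ((i : ℝ) / k) ^ γ ≤ 1 :=
      Real.rpow_le_one (by positivity) (div_le_one_of_le₀ hik' (by positivity)) hγ.le
    have := mul_le_mul_of_nonneg_left h3 hC.le
    nlinarith
  have h4 : Real.exp (γ' * logPlus i ^ (1 - ε)) ≤ Real.exp (γ' * logPlus k ^ (1 - ε)) := by
    refine Real.exp_le_exp.2 (mul_le_mul_of_nonneg_left ?_ hγ'.le)
    exact Real.rpow_le_rpow (logPlus_pos _).le (logPlus_mono hik') (by linarith)
  calc _ ≤ M * Real.exp (γ' * logPlus i ^ (1 - ε)) * d i := h1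
    _ ≤ M * Real.exp (γ' * logPlus k ^ (1 - ε)) * (C * d k) := by gcongr
    _ = _ := by ring

/-- Every index min(j, k) is at most k, so each moment costs d k; summing 1/j gives the logarithm,
and d k / d l gives the power. The slowly varying factors are taken at N to be uniform over pairs.
-/
theorem exists_integral_dominating_le [IsProbabilityMeasure P]
    (hd_pos : ∀ n : ℕ, 1 ≤ n → 0 < d n) (hγ : 0 < γ)
    {C : ℝ} (hC : 0 < C)
    (hgrow : ∀ k l : ℕ, 1 ≤ k → k ≤ l → d k / d l ≤ C * ((k : ℝ) / l) ^ γ)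
    (hγ' : 0 < γ') (hε : ε ≤ 1)
    (hS_int : ∀ n : ℕ, 1 ≤ n → Integrable (partialSum Y n) P)
    (hS_bound : (fun n : ℕ => ∫ ω, |(partialSum Y n ω - m * (n : ℝ)) / d n| ∂P)
      =O[atTop] (fun n : ℕ => Real.exp (γ' * logPlus n ^ (1 - ε)))) :
    ∃ M : ℝ, 0 < M ∧ ∀ k l N : ℕ, 1 ≤ k → k ≤ l → l ≤ N →
      ∫ ω, (1 / d l) * ∑ j ∈ Finset.Icc 1 l,
        |partialSum Y (min j k) ω - m * (min j k : ℕ)| * (1 / (j : ℝ)) ∂P ≤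
        M * ((k : ℝ) / l) ^ γ * (Real.exp (γ' * logPlus N ^ (1 - ε)) * logPlus N) := by
  obtain ⟨M, hM, h⟩ :=
    exists_integral_abs_partialSum_le hd_pos hγ hC hgrow hγ' hε hS_bound
  refine ⟨M * C * 2, by positivity, fun k l N hk hkl hlN => ?_⟩
  have hdk := hd_pos k hk
  have hdl := hd_pos l (hk.trans hkl)
  have hkN : (k : ℝ) ≤ N := by exact_mod_cast hkl.trans hlN
  have hlN' : (l : ℝ) ≤ N := by exact_mod_cast hlN
  have hLk := logPlus_pos k
  have hLN := logPlus_pos N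
  rw [integral_const_mul, integral_finsetSum]
  swap
  · intro j hj
    rw [Finset.mem_Icc] at hj
    exact (((hS_int _ (le_min hj.1 hk)).sub (integrable_const _)).abs).mul_const _
  calc _ ≤ (1 / d l) * ∑ j ∈ Finset.Icc 1 l,
          M * (d k * Real.exp (γ' * logPlus k ^ (1 - ε))) * (1 / (j : ℝ)) := by
        refine mul_le_mul_of_nonneg_left (Finset.sum_le_sum fun j hj => ?_) (by positivity)
        rw [Finset.mem_Icc] at hj
        rw [integral_mul_const]
        exact mul_le_mul_of_nonneg_right (h _ k (le_min hj.1 hk) (min_le_right _ _))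
          (by positivity)
    _ ≤ (1 / d l) * (M * (d k * Real.exp (γ' * logPlus N ^ (1 - ε))) * (2 * logPlus N)) := by
        rw [← Finset.mul_sum]
        have h1 : ∑ j ∈ Finset.Icc 1 l, 1 / (j : ℝ) ≤ 2 * logPlus N :=
          (sum_one_div_le_two_mul_logPlus l).trans (by linarith [logPlus_mono hlN'])
        have h2 : logPlus k ^ (1 - ε) ≤ logPlus N ^ (1 - ε) :=
          Real.rpow_le_rpow hLk.le (logPlus_mono hkN) (by linarith)
        gcongr
    _ = d k / d l * (M * 2 * (Real.exp (γ' * logPlus N ^ (1 - ε)) * logPlus N)) := by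
        field_simp
    _ ≤ C * ((k : ℝ) / l) ^ γ * (M * 2 * (Real.exp (γ' * logPlus N ^ (1 - ε)) * logPlus N)) := by
        gcongr
        exact hgrow k l hk hkl
    _ = _ := by ring

end Covariance

/-! ### From covariance decay to almost sure convergence -/

theorem abs_sum_Icc_sub_sum_Icc_le {a : ℕ → ℝ} (ha : ∀ n, |a n| ≤ 1) {p q : ℕ} (hp : 1 ≤ p)
    (hpq : p ≤ q) :
    |∑ n ∈ Finset.Icc 1 q, 1 / (n : ℝ) * a n - ∑ n ∈ Finset.Icc 1 p, 1 / (n : ℝ) * a n| ≤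
      1 + (Real.log q - Real.log p) := by
  have hsub : Finset.Icc 1 p ⊆ Finset.Icc 1 q := Finset.Icc_subset_Icc_right hpq
  rw [← Finset.sum_sdiff hsub, add_sub_cancel_right]
  refine (Finset.abs_sum_le_sum_abs _ _).trans (le_trans ?_ (sum_Icc_one_div_le hp hpq))
  refine (Finset.sum_le_sum fun n _ => ?_).trans (Finset.sum_le_sum_of_subset_of_nonneg
    (fun n hn => ?_) fun n _ _ => by positivity)
  · rw [abs_mul, abs_of_nonneg (by positivity : (0 : ℝ) ≤ 1 / n)]
    exact mul_le_of_le_one_right (by positivity) (ha n)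
  · simp only [Finset.mem_sdiff, Finset.mem_Icc] at hn ⊢
    omega

/-- The series of squares has finite expectation, so it converges almost surely and its terms vanish
in the limit. -/
theorem ae_tendsto_zero_of_integral_sq_summable {Ω : Type*} [MeasurableSpace Ω] {P : Measure Ω}
    {F : ℕ → Ω → ℝ} (hF : ∀ i, Measurable (F i))
    (hint : ∀ i, Integrable (fun ω => F i ω ^ 2) P) {b : ℕ → ℝ} (hb : Summable b)
    (hFb : ∀ i, ∫ ω, F i ω ^ 2 ∂P ≤ b i) :
    ∀ᵐ ω ∂P, Tendsto (fun i => F i ω) atTop (𝓝 0) := by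
  have hmeas : ∀ i, Measurable fun ω => ENNReal.ofReal (F i ω ^ 2) := fun i =>
    ((hF i).pow_const 2).ennreal_ofReal
  have hfin : ∫⁻ ω, ∑' i, ENNReal.ofReal (F i ω ^ 2) ∂P ≠ ⊤ := by
    rw [lintegral_tsum fun i => (hmeas i).aemeasurable]
    refine ne_top_of_le_ne_top hb.tsum_ofReal_ne_top (ENNReal.tsum_le_tsum fun i => ?_)
    rw [← ofReal_integral_eq_lintegral_ofReal (hint i) (Eventually.of_forall fun _ => sq_nonneg _)]
    exact ENNReal.ofReal_le_ofReal (hFb i)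
  filter_upwards [ae_lt_top (Measurable.tsum hmeas) hfin] with ω hω
  have h1 := ENNReal.tendsto_atTop_zero_of_tsum_ne_top hω.ne
  have h2 : Tendsto (fun i => F i ω ^ 2) atTop (𝓝 0) := by
    have := (ENNReal.tendsto_toReal ENNReal.zero_ne_top).comp h1
    refine this.congr fun i => ?_
    simp [ENNReal.toReal_ofReal (sq_nonneg _)]
  have h3 := h2.sqrt
  simp only [Real.sqrt_sq_eq_abs, Real.sqrt_zero] at h3
  exact (tendsto_zero_iff_abs_tendsto_zero _).2 h3

section

variable {Ω : Type*} [MeasurableSpace Ω] {P : Measure Ω} [IsProbabilityMeasure P]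

/-- Covariance decay for a bounded Lipschitz function of the normalized sums. -/
theorem exists_abs_covariance_le {Y : ℕ → Ω → ℝ} {d : ℕ → ℝ} {γ m γ' ε t : ℝ}
    (hY_meas : ∀ n : ℕ, 1 ≤ n → Measurable (Y n))
    (hY_indep : iIndepFun (fun n : ℕ => Y (n + 1)) P)
    (hd_pos : ∀ n : ℕ, 1 ≤ n → 0 < d n) (hγ : 0 < γ) {C : ℝ} (hC : 0 < C)
    (hgrow : ∀ k l : ℕ, 1 ≤ k → k ≤ l → d k / d l ≤ C * ((k : ℝ) / l) ^ γ)
    (hγ' : 0 < γ') (hε : ε ≤ 1)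
    (hS_int : ∀ n : ℕ, 1 ≤ n → Integrable (partialSum Y n) P)
    (hS_bound : (fun n : ℕ => ∫ ω, |(partialSum Y n ω - m * (n : ℝ)) / d n| ∂P)
      =O[atTop] (fun n : ℕ => Real.exp (γ' * logPlus n ^ (1 - ε))))
    (ht : t ≤ 1) {φ : ℝ → ℝ} (hφ : Measurable φ) (hφ01 : ∀ y, φ y ∈ Set.Icc (0 : ℝ) 1)
    {K : ℝ} (hK : 0 < K) (hφK : ∀ y z, |φ y - φ z| ≤ K * |y - z|) :
    ∃ M : ℝ, 0 < M ∧ ∀ k l N : ℕ, 1 ≤ k → k ≤ l → l ≤ N →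
      |∫ ω, (φ (normalizedSum Y d m t k ω) - ∫ ω', φ (normalizedSum Y d m t k ω') ∂P) *
        (φ (normalizedSum Y d m t l ω) - ∫ ω', φ (normalizedSum Y d m t l ω') ∂P) ∂P| ≤
        M * ((k : ℝ) / l) ^ γ * (Real.exp (γ' * logPlus N ^ (1 - ε)) * logPlus N) := by
  obtain ⟨M, hM, h⟩ :=
    exists_integral_dominating_le hd_pos hγ hC hgrow hγ' hε hS_int hS_bound
  refine ⟨K * M, by positivity, fun k l N hk hkl hlN => ?_⟩
  have hX : ∀ n, Measurable (normalizedSum Y d m t n) := fun n =>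
    measurable_normalizedSum ht fun i hi _ => hY_meas i hi
  have hZ : Measurable (remainderSum Y d m t k l) :=
    measurable_remainderSum fun n hn => hY_meas n (by omega)
  have habs : ∀ y, |φ y| ≤ 1 := fun y => by
    rw [abs_of_nonneg (hφ01 y).1]; exact (hφ01 y).2
  have hint : Integrable (fun ω => φ (normalizedSum Y d m t k ω)) P :=
    Integrable.of_bound (hφ.comp (hX k)).aestronglyMeasurable 1
      (Eventually.of_forall fun ω => habs _)
  have hEk : ∫ ω', φ (normalizedSum Y d m t k ω') ∂P ∈ Set.Icc (0 : ℝ) 1 := by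
    refine ⟨integral_nonneg fun ω => (hφ01 _).1, ?_⟩
    have := integral_mono hint (integrable_const (1 : ℝ)) fun ω => (hφ01 _).2
    simpa using this
  have hdl := hd_pos l (hk.trans hkl)
  have hind : IndepFun (fun ω => φ (normalizedSum Y d m t k ω) -
      ∫ ω', φ (normalizedSum Y d m t k ω') ∂P) (fun ω => φ (remainderSum Y d m t k l ω)) P :=
    (indepFun_normalizedSum_remainderSum hY_meas hY_indep ht k l).comp
      (hφ.sub_const (∫ ω', φ (normalizedSum Y d m t k ω') ∂P)) hφ
  refine (abs_integral_mul_le_of_indepFun (K := K)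
    (D := fun ω => (1 / d l) * ∑ j ∈ Finset.Icc 1 l,
        |partialSum Y (min j k) ω - m * (min j k : ℕ)| * (1 / (j : ℝ)))
    ((hφ.comp (hX k)).sub_const _) (hφ.comp (hX l)) (hφ.comp hZ) ?_ (fun _ => habs _)
    (fun _ => habs _) ?_ hind ?_ ?_).trans ?_
  · intro ω
    have := hφ01 (normalizedSum Y d m t k ω)
    rw [Function.comp_apply, abs_le]
    constructor <;> linarith [this.1, this.2, hEk.1, hEk.2]
  · simp only [Function.comp_apply]
    rw [integral_sub hint (integrable_const _)]
    simp
  · intro ω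
    exact (hφK _ _).trans (mul_le_mul_of_nonneg_left
      (abs_normalizedSum_sub_remainderSum_le Y m ht k hdl ω) hK.le)
  · refine (integrable_finsetSum _ fun j hj => ?_).const_mul _
    rw [Finset.mem_Icc] at hj
    exact (((hS_int _ (le_min hj.1 hk)).sub (integrable_const _)).abs).mul_const _
  · refine (mul_le_mul_of_nonneg_left (h k l N hk hkl hlN) hK.le).trans (le_of_eq ?_)
    ring

/-- Covariance decay bounds the second moment of logarithmic averages. -/
theorem exists_integral_sq_logAverage_le {g : ℕ → Ω → ℝ} (hg : ∀ n, Measurable (g n))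
    (hg1 : ∀ n ω, |g n ω| ≤ 1) {γ γ' ε M : ℝ} (hγ : 0 < γ) (hγ' : 0 < γ') (hε : ε ≤ 1 / 2)
    (hM : 0 < M)
    (hcov : ∀ k l N : ℕ, 1 ≤ k → k ≤ l → l ≤ N → |∫ ω, g k ω * g l ω ∂P| ≤
        M * ((k : ℝ) / l) ^ γ * (Real.exp (γ' * logPlus N ^ (1 - ε)) * logPlus N)) :
    ∃ C : ℝ, 0 < C ∧ ∀ N : ℕ,
      ∫ ω, (logAverage (fun n => g n ω) N) ^ 2 ∂P ≤ C * logPlus N ^ (-ε) := by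
  have hgg1 : ∀ k l ω, |g k ω * g l ω| ≤ 1 := fun k l ω => by
    rw [abs_mul]; exact mul_le_one₀ (hg1 k ω) (abs_nonneg _) (hg1 l ω)
  have hgg : ∀ k l, Integrable (fun ω => g k ω * g l ω) P := fun k l =>
    Integrable.of_bound ((hg k).mul (hg l)).aestronglyMeasurable 1
      (Eventually.of_forall (hgg1 k l))
  -- The first summand comes from the diagonal band, 96 = 24 · 2² from the pairs outside it.
  refine ⟨2 * (1 + 2 * ((γ' + 1) / γ)) + 96 * M, by positivity, fun N => ?_⟩
  set L := logPlus N with hLdef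
  have hL1 : 1 ≤ L := one_le_logPlus N
  have hL0 : 0 < L := logPlus_pos N
  -- Beyond this distance (k/l)^γ beats exp(γ' L^(1-ε)) by a factor exp(-L^(1-ε)).
  set R := (γ' + 1) / γ * L ^ (1 - ε) with hR
  have hR0 : 0 ≤ R := by positivity
  set r : ℕ → ℕ → ℝ := fun k l => ∫ ω, g k ω * g l ω ∂P with hr
  have hr1 : ∀ k l, r k l ≤ 1 := fun k l => by
    have := integral_mono (hgg k l) (integrable_const (1 : ℝ)) fun ω => (abs_le.1 (hgg1 k l ω)).2
    simpa using this
  have hfar : ∀ k l, 1 ≤ k → k ≤ l → l ≤ N → R < Real.log l - Real.log k →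
      r k l ≤ M * (24 * L ^ (-ε)) := by
    intro k l hk hkl hlN hlog
    have hk0 : (0 : ℝ) < k := by exact_mod_cast hk
    have hl0 : (0 : ℝ) < l := by exact_mod_cast hk.trans hkl
    have h1 : ((k : ℝ) / l) ^ γ ≤ Real.exp (-((γ' + 1) * L ^ (1 - ε))) := by
      rw [Real.rpow_def_of_pos (by positivity), Real.log_div hk0.ne' hl0.ne', Real.exp_le_exp]
      have h2 := mul_le_mul_of_nonneg_right hlog.le hγ.le
      have h3 : R * γ = (γ' + 1) * L ^ (1 - ε) := by rw [hR]; field_simp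
      linarith
    calc r k l ≤ M * ((k : ℝ) / l) ^ γ * (Real.exp (γ' * L ^ (1 - ε)) * L) :=
          (le_abs_self _).trans (hcov k l N hk hkl hlN)
      _ ≤ M * Real.exp (-((γ' + 1) * L ^ (1 - ε))) * (Real.exp (γ' * L ^ (1 - ε)) * L) := by
          gcongr
      _ = M * ((Real.exp (-((γ' + 1) * L ^ (1 - ε))) * Real.exp (γ' * L ^ (1 - ε))) * L) := by
          ring
      _ = M * (Real.exp (-L ^ (1 - ε)) * L) := by rw [← Real.exp_add]; ring_nf
      _ ≤ _ := mul_le_mul_of_nonneg_left (exp_neg_rpow_mul_le hε hL1) hM.le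
  have hsum := sum_sum_le_of_offDiagonal (r := r) (N := N) (δ := M * (24 * L ^ (-ε))) hR0
    (by positivity) (fun k _ l _ => hr1 k l) (by
      intro k hk l hl h
      rw [Finset.mem_Icc] at hk hl
      have hk0 : (0 : ℝ) < k := by exact_mod_cast hk.1
      have hl0 : (0 : ℝ) < l := by exact_mod_cast hl.1
      rcases le_total k l with hkl | hkl
      · refine hfar k l hk.1 hkl hl.2 ?_
        have := Real.log_le_log hk0 (show (k : ℝ) ≤ l by exact_mod_cast hkl)
        rwa [abs_sub_comm, abs_of_nonneg (by linarith)] at h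
      · have hsymm : r k l = r l k := by simp only [hr, mul_comm]
        rw [hsymm]
        refine hfar l k hl.1 hkl hk.2 ?_
        have := Real.log_le_log hl0 (show (l : ℝ) ≤ k by exact_mod_cast hkl)
        rwa [abs_of_nonneg (by linarith)] at h)
  have hexp : ∫ ω, (logAverage (fun n => g n ω) N) ^ 2 ∂P = (1 / L) ^ 2 *
      ∑ l ∈ Finset.Icc 1 N, ∑ k ∈ Finset.Icc 1 N, 1 / (l : ℝ) * (1 / (k : ℝ)) * r k l := by
    have e : ∀ ω, (logAverage (fun n => g n ω) N) ^ 2 = (1 / L) ^ 2 *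
        ∑ l ∈ Finset.Icc 1 N, ∑ k ∈ Finset.Icc 1 N,
          1 / (l : ℝ) * (1 / (k : ℝ)) * (g k ω * g l ω) := fun ω => by
      rw [logAverage, mul_pow, sq (∑ n ∈ Finset.Icc 1 N, _), Finset.sum_mul_sum]
      congr 1
      refine Finset.sum_congr rfl fun l _ => Finset.sum_congr rfl fun k _ => ?_
      ring
    simp only [e]
    rw [integral_const_mul, integral_finsetSum]
    · congr 1
      refine Finset.sum_congr rfl fun l _ => ?_
      rw [integral_finsetSum _ fun k _ => (hgg k l).const_mul _]
      exact Finset.sum_congr rfl fun k _ => integral_const_mul _ _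
    · exact fun l _ => integrable_finsetSum _ fun k _ => (hgg k l).const_mul _
  rw [hexp]
  have hpow : 1 ≤ L ^ (1 - ε) := Real.one_le_rpow hL1 (by linarith)
  have hmul : L ^ (1 - ε) = L * L ^ (-ε) := by
    rw [sub_eq_add_neg, Real.rpow_add hL0, Real.rpow_one]
  calc _ ≤ (1 / L) ^ 2 * (2 * L * (1 + 2 * R) + M * (24 * L ^ (-ε)) * (2 * L) ^ 2) := by gcongr
    _ ≤ (1 / L) ^ 2 * (2 * L * (L ^ (1 - ε) + 2 * R) + M * (24 * L ^ (-ε)) * (2 * L) ^ 2) := by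
        gcongr
    _ = _ := by
        rw [hR, hmul]
        field_simp
        ring

/-- A second moment bound by a negative power of the logarithm gives almost sure convergence. -/
theorem ae_tendsto_logAverage_zero {g : ℕ → Ω → ℝ} (hg : ∀ n, Measurable (g n))
    (hg1 : ∀ n ω, |g n ω| ≤ 1) {ε C : ℝ} (hε : 0 < ε)
    (hvar : ∀ N : ℕ, ∫ ω, (logAverage (fun n => g n ω) N) ^ 2 ∂P ≤ C * logPlus N ^ (-ε)) :
    ∀ᵐ ω ∂P, Tendsto (logAverage fun n => g n ω) atTop (𝓝 0) := by
  -- With exponent q + 1, the second moments along the subsequence are O(i^(-2)).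
  obtain ⟨q, hq⟩ := exists_nat_ge (2 / ε)
  have hqε : 2 ≤ ((q + 1 : ℕ) : ℝ) * ε := by
    rw [div_le_iff₀ hε] at hq
    push_cast
    nlinarith
  set s : ℕ → ℕ := fun i => ⌈Real.exp ((i : ℝ) ^ (q + 1))⌉₊ with hs
  have hsL : ∀ i : ℕ, 1 ≤ i → (i : ℝ) ^ (q + 1) ≤ logPlus (s i) := fun i hi => by
    obtain ⟨h1, h2, -⟩ := logPlus_ceil_exp_bounds (p := q + 1) hi
    exact h2.trans (log_le_logPlus (by exact_mod_cast h1))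
  have hs_top : Tendsto s atTop atTop := by
    refine tendsto_atTop_mono (fun i => ?_) tendsto_id
    have h1 : (i : ℝ) ≤ s i := by
      refine le_trans ?_ (Nat.le_ceil _)
      rcases Nat.eq_zero_or_pos i with rfl | hi
      · simp
      have : (1 : ℝ) ≤ i := by exact_mod_cast hi
      have : (i : ℝ) ≤ (i : ℝ) ^ (q + 1) := le_self_pow₀ this (Nat.succ_ne_zero q)
      have := Real.add_one_le_exp ((i : ℝ) ^ (q + 1))
      linarith
    exact_mod_cast h1
  have hmeas : ∀ N, Measurable fun ω => logAverage (fun n => g n ω) N := fun N =>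
    (Finset.measurable_fun_sum _ fun n _ => (hg n).const_mul _).const_mul _
  have hbdd : ∀ N ω, |logAverage (fun n => g n ω) N| ≤ 2 := fun N ω => by
    have hL := logPlus_pos N
    rw [logAverage, abs_mul, abs_of_pos (by positivity : 0 < 1 / logPlus N), one_div,
      inv_mul_le_iff₀ hL, mul_comm]
    refine (Finset.abs_sum_le_sum_abs _ _).trans
      ((Finset.sum_le_sum fun n _ => ?_).trans (sum_one_div_le_two_mul_logPlus N))
    rw [abs_mul, abs_of_nonneg (by positivity : (0 : ℝ) ≤ 1 / n)]
    exact mul_le_of_le_one_right (by positivity) (hg1 n ω)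
  have hsub := ae_tendsto_zero_of_integral_sq_summable (P := P)
    (F := fun i ω => logAverage (fun n => g n ω) (s i)) (fun i => hmeas (s i))
    (fun i => Integrable.of_bound ((hmeas (s i)).pow_const 2).aestronglyMeasurable 4
      (Eventually.of_forall fun ω => by
        rw [norm_pow, Real.norm_eq_abs]
        have := hbdd (s i) ω
        nlinarith [abs_nonneg (logAverage (fun n => g n ω) (s i))]))
    (b := fun i => C * logPlus (s i) ^ (-ε)) (by
      refine Summable.mul_left C ?_
      refine Summable.of_norm_bounded_eventually_nat
        (Real.summable_one_div_nat_pow.2 (one_lt_two : 1 < 2)) ?_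
      filter_upwards [eventually_ge_atTop 1] with i hi
      have hi1 : (1 : ℝ) ≤ i := by exact_mod_cast hi
      have hL := logPlus_pos (s i)
      rw [Real.norm_of_nonneg (by positivity)]
      calc logPlus (s i) ^ (-ε) ≤ ((i : ℝ) ^ (q + 1)) ^ (-ε) :=
            Real.rpow_le_rpow_of_nonpos (by positivity) (hsL i hi) (by linarith)
        _ = (i : ℝ) ^ (-(((q + 1 : ℕ) : ℝ) * ε)) := by
            rw [← Real.rpow_natCast, ← Real.rpow_mul (by positivity)]
            ring_nf
        _ ≤ (i : ℝ) ^ (-2 : ℝ) := Real.rpow_le_rpow_of_exponent_le hi1 (by linarith)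
        _ = 1 / (i : ℝ) ^ 2 := by
            rw [Real.rpow_neg (by positivity), one_div]; norm_cast)
    (fun i => hvar (s i))
  filter_upwards [hsub] with ω hω
  have hdiv : ∀ N, logAverage (fun n => g n ω) N =
      (∑ n ∈ Finset.Icc 1 N, 1 / (n : ℝ) * g n ω) / logPlus N := fun N => by
    rw [logAverage]; ring
  refine Tendsto.congr (fun N => (hdiv N).symm) ?_
  -- In `c`, the 2 is the 1 from the harmonic sum plus the 1 from rounding up exp((i+1)^(q+1)).
  refine tendsto_div_zero_of_subseq (L := fun N : ℕ => logPlus N)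
    (fun a b h => logPlus_mono (by exact_mod_cast h)) (fun N => logPlus_pos N)
    (fun p r hp hpr => abs_sum_Icc_sub_sum_Icc_le (fun n => hg1 n ω) hp hpr) hs_top
    (c := fun i => 2 + (((i + 1 : ℕ) : ℝ) ^ (q + 1) - (i : ℝ) ^ (q + 1))) (fun i hi => ?_) ?_
    (hω.congr fun i => hdiv (s i))
  · obtain ⟨h1, h2, -⟩ := logPlus_ceil_exp_bounds (p := q + 1) hi
    obtain ⟨-, -, h3⟩ := logPlus_ceil_exp_bounds (p := q + 1) (Nat.le_add_left 1 i)
    exact ⟨h1, by simp only [hs]; linarith⟩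
  · have hnn : ∀ i : ℕ, 0 ≤ 2 + (((i + 1 : ℕ) : ℝ) ^ (q + 1) - (i : ℝ) ^ (q + 1)) := fun i => by
      have : (i : ℝ) ^ (q + 1) ≤ ((i + 1 : ℕ) : ℝ) ^ (q + 1) := by
        gcongr; simp
      linarith
    refine squeeze_zero' (Eventually.of_forall fun i => div_nonneg (hnn i) (logPlus_pos _).le)
      ?_ (tendsto_succ_pow_sub_div q)
    filter_upwards [eventually_ge_atTop 1] with i hi
    have hi0 : (0 : ℝ) < i := by exact_mod_cast hi
    exact div_le_div_of_nonneg_left (hnn i) (by positivity) (hsL i hi)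

end

/-! ### Ramp functions between indicators -/

/-- The continuous function equal to `1` left of `a`, to `0` right of `b`, linear in between. -/
noncomputable def ramp (a b y : ℝ) : ℝ := max 0 (min 1 ((b - y) / (b - a)))

theorem ramp_mem_Icc (a b y : ℝ) : ramp a b y ∈ Set.Icc (0 : ℝ) 1 :=
  ⟨le_max_left _ _, max_le zero_le_one (min_le_left _ _)⟩

theorem ramp_of_le {a b y : ℝ} (hab : a < b) (hy : y ≤ a) : ramp a b y = 1 := by
  have h : 1 ≤ (b - y) / (b - a) := by rw [le_div_iff₀ (sub_pos.2 hab)]; linarith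
  rw [ramp, min_eq_left h, max_eq_right zero_le_one]

theorem ramp_of_ge {a b y : ℝ} (hab : a < b) (hy : b ≤ y) : ramp a b y = 0 := by
  have h : (b - y) / (b - a) ≤ 0 := div_nonpos_of_nonpos_of_nonneg (by linarith) (by linarith)
  rw [ramp, max_eq_left ((min_le_right _ _).trans h)]

theorem measurable_ramp (a b : ℝ) : Measurable (ramp a b) :=
  measurable_const.max (measurable_const.min ((measurable_const.sub measurable_id).div_const _))

theorem abs_ramp_sub_ramp_le {a b : ℝ} (hab : a < b) (y z : ℝ) :
    |ramp a b y - ramp a b z| ≤ (1 / (b - a)) * |y - z| := by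
  have h0 : 0 < b - a := sub_pos.2 hab
  have hmin : |min 1 ((b - y) / (b - a)) - min 1 ((b - z) / (b - a))| ≤
      |(b - y) / (b - a) - (b - z) / (b - a)| := by
    simpa using abs_min_sub_min_le_max 1 ((b - y) / (b - a)) 1 ((b - z) / (b - a))
  have hmax : |ramp a b y - ramp a b z| ≤
      |min 1 ((b - y) / (b - a)) - min 1 ((b - z) / (b - a))| := by
    simpa [ramp] using
      abs_max_sub_max_le_max 0 (min 1 ((b - y) / (b - a))) 0 (min 1 ((b - z) / (b - a)))
  refine (hmax.trans hmin).trans (le_of_eq ?_)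
  rw [← sub_div, abs_div, abs_of_pos h0, abs_sub_comm]
  ring_nf

theorem indicator_le_ramp {Ω : Type*} {a b : ℝ} (hab : a < b) (X : Ω → ℝ) (ω : Ω) :
    Set.indicator {ω' | X ω' ≤ a} (fun _ => (1 : ℝ)) ω ≤ ramp a b (X ω) := by
  by_cases h : X ω ≤ a
  · rw [Set.indicator_of_mem (by exact h), ramp_of_le hab h]
  · rw [Set.indicator_of_notMem (by exact h)]
    exact (ramp_mem_Icc a b _).1

theorem ramp_le_indicator {Ω : Type*} {a b : ℝ} (hab : a < b) (X : Ω → ℝ) (ω : Ω) :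
    ramp a b (X ω) ≤ Set.indicator {ω' | X ω' ≤ b} (fun _ => (1 : ℝ)) ω := by
  by_cases h : X ω ≤ b
  · rw [Set.indicator_of_mem (by exact h)]
    exact (ramp_mem_Icc a b _).2
  · rw [Set.indicator_of_notMem (by exact h), ramp_of_ge hab (not_le.1 h).le]

section

variable {Ω : Type*} [MeasurableSpace Ω] {P : Measure Ω} [IsProbabilityMeasure P]

theorem integrable_ramp (a b : ℝ) {X : Ω → ℝ} (hX : Measurable X) :
    Integrable (fun ω => ramp a b (X ω)) P :=
  Integrable.of_bound ((measurable_ramp a b).comp hX).aestronglyMeasurable 1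
    (Eventually.of_forall fun ω => by
      rw [Real.norm_of_nonneg (ramp_mem_Icc a b _).1]
      exact (ramp_mem_Icc a b _).2)

theorem integrable_indicator_le (a : ℝ) {X : Ω → ℝ} (hX : Measurable X) :
    Integrable (Set.indicator {ω' | X ω' ≤ a} (fun _ => (1 : ℝ))) P :=
  (integrable_const 1).indicator (measurableSet_le hX measurable_const)

theorem measureReal_le_integral_ramp {a b : ℝ} (hab : a < b) {X : Ω → ℝ} (hX : Measurable X) :
    P.real {ω | X ω ≤ a} ≤ ∫ ω, ramp a b (X ω) ∂P := by
  rw [← integral_indicator_one (measurableSet_le hX measurable_const)]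
  exact integral_mono (integrable_indicator_le a hX) (integrable_ramp a b hX)
    (indicator_le_ramp hab X)

theorem integral_ramp_le_measureReal {a b : ℝ} (hab : a < b) {X : Ω → ℝ} (hX : Measurable X) :
    ∫ ω, ramp a b (X ω) ∂P ≤ P.real {ω | X ω ≤ b} := by
  rw [← integral_indicator_one (measurableSet_le hX measurable_const)]
  exact integral_mono (integrable_ramp a b hX) (integrable_indicator_le b hX)
    (ramp_le_indicator hab X)

end

/-! ### The equivalence by sandwiching -/

/-- Serves both directions: u is the average known to converge and v the target, one of indicators
and one of probabilities; F and H are the ramp averages on the side of u and of v. -/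
theorem eventually_abs_sub_lt_of_sandwich {ua ub vx Fl Hl Fr Hr : ℕ → ℝ} {Ga Gb Gx η : ℝ}
    (h1 : ∀ N, ua N ≤ Fl N) (h2 : ∀ N, Hl N ≤ vx N) (h3 : ∀ N, Fr N ≤ ub N)
    (h4 : ∀ N, vx N ≤ Hr N) (hl : Tendsto (fun N => Fl N - Hl N) atTop (𝓝 0))
    (hr : Tendsto (fun N => Fr N - Hr N) atTop (𝓝 0)) (ha : Tendsto ua atTop (𝓝 Ga))
    (hb : Tendsto ub atTop (𝓝 Gb)) (hGa : Gx - η < Ga) (hGb : Gb < Gx + η) :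
    ∀ᶠ N in atTop, |vx N - Gx| < η := by
  have ha' := ha.sub hl
  have hb' := hb.sub hr
  rw [sub_zero] at ha' hb'
  filter_upwards [ha'.eventually_const_lt hGa, hb'.eventually_lt_const hGb] with N hN hN'
  rw [abs_lt]
  constructor <;> linarith [h1 N, h2 N, h3 N, h4 N]

/-- Continuity points of a monotone function are dense, so those of `f` near a continuity point
give values arbitrarily close from both sides. -/
theorem exists_continuityPoints_near {f : ℝ → ℝ} (hf : Monotone f) {x : ℝ}
    (hx : ContinuousAt f x) {η : ℝ} (hη : 0 < η) :
    ∃ a b, a < x ∧ x < b ∧ ContinuousAt f a ∧ ContinuousAt f b ∧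
      f x - η < f a ∧ f b < f x + η := by
  have hdense : Dense {y | ContinuousAt f y} := by
    have := hf.countable_not_continuousAt.dense_compl ℝ
    simpa [Set.compl_ofPred] using this
  obtain ⟨δ, hδ, h⟩ := Metric.continuousAt_iff.1 hx η hη
  obtain ⟨a, ha, ha1, ha2⟩ := hdense.exists_between (show x - δ < x by linarith)
  obtain ⟨b, hb, hb1, hb2⟩ := hdense.exists_between (show x < x + δ by linarith)
  have h1 := h (x := a) (by rw [Real.dist_eq, abs_lt]; constructor <;> linarith)
  have h2 := h (x := b) (by rw [Real.dist_eq, abs_lt]; constructor <;> linarith)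
  rw [Real.dist_eq, abs_lt] at h1 h2
  exact ⟨a, b, ha2, hb1, ha, hb, by linarith [h1.1], by linarith [h2.2]⟩

section

variable {Ω : Type*} [MeasurableSpace Ω] {P : Measure Ω} [IsProbabilityMeasure P]

/-- If logarithmic averages of ramp functions concentrate around their means, then almost sure
and averaged convergence in distribution are equivalent. -/
theorem ae_tendsto_logAverage_iff {X : ℕ → Ω → ℝ} (hX : ∀ n, Measurable (X n)) {f : ℝ → ℝ}
    (hf : Monotone f)
    (hconc : ∀ a b : ℝ, a < b → ∀ᵐ ω ∂P, Tendsto (fun N =>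
      logAverage (fun n => ramp a b (X n ω)) N -
        logAverage (fun n => ∫ ω', ramp a b (X n ω') ∂P) N) atTop (𝓝 0)) :
    (∀ x : ℝ, ContinuousAt f x → ∀ᵐ ω ∂P,
      Tendsto (logAverage fun n : ℕ =>
        Set.indicator {ω' : Ω | X n ω' ≤ x} (fun _ => (1 : ℝ)) ω) atTop (𝓝 (f x))) ↔
    (∀ x : ℝ, ContinuousAt f x →
      Tendsto (logAverage fun n : ℕ => P.real {ω' : Ω | X n ω' ≤ x}) atTop (𝓝 (f x))) := by
  constructor
  · intro h x hx
    refine Metric.tendsto_nhds.2 fun η hη => ?_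
    obtain ⟨a, b, hax, hxb, ha, hb, hfa, hfb⟩ := exists_continuityPoints_near hf hx hη
    -- The conclusion is deterministic, so a single good ω suffices.
    obtain ⟨ω, hωa, hωb, hl, hr⟩ :=
      ((h a ha).and ((h b hb).and ((hconc a x hax).and (hconc x b hxb)))).exists
    exact eventually_abs_sub_lt_of_sandwich
      (logAverage_mono fun n _ => indicator_le_ramp hax (X n) ω)
      (logAverage_mono fun n _ => integral_ramp_le_measureReal hax (hX n))
      (logAverage_mono fun n _ => ramp_le_indicator hxb (X n) ω)
      (logAverage_mono fun n _ => measureReal_le_integral_ramp hxb (hX n))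
      hl hr hωa hωb hfa hfb
  · intro h x hx
    -- The null set depends on a and b, hence on the tolerance; restricting to tolerances 1/(j+1)
    -- keeps the union countable.
    have key : ∀ j : ℕ, ∀ᵐ ω ∂P, ∀ᶠ N in atTop, |logAverage (fun n : ℕ =>
        Set.indicator {ω' : Ω | X n ω' ≤ x} (fun _ => (1 : ℝ)) ω) N - f x| < 1 / ((j : ℝ) + 1) := by
      intro j
      obtain ⟨a, b, hax, hxb, ha, hb, hfa, hfb⟩ :=
        exists_continuityPoints_near hf hx (Nat.one_div_pos_of_nat (n := j) (α := ℝ))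
      filter_upwards [hconc a x hax, hconc x b hxb] with ω hl hr
      have hl' := hl.neg
      have hr' := hr.neg
      simp only [neg_sub, neg_zero] at hl' hr'
      exact eventually_abs_sub_lt_of_sandwich
        (logAverage_mono fun n _ => measureReal_le_integral_ramp hax (hX n))
        (logAverage_mono fun n _ => ramp_le_indicator hax (X n) ω)
        (logAverage_mono fun n _ => integral_ramp_le_measureReal hxb (hX n))
        (logAverage_mono fun n _ => indicator_le_ramp hxb (X n) ω)
        hl' hr' (h a ha) (h b hb) hfa hfb
    filter_upwards [ae_all_iff.2 key] with ω hω
    refine Metric.tendsto_nhds.2 fun η hη => ?_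
    obtain ⟨j, hj⟩ := exists_nat_one_div_lt hη
    filter_upwards [hω j] with N hN
    exact hN.trans hj

/-- Concentration of logarithmic averages of bounded Lipschitz functions of the normalized sums. -/
theorem ae_tendsto_logAverage_sub_integral {Y : ℕ → Ω → ℝ} {d : ℕ → ℝ} {γ m γ' ε t : ℝ}
    (hY_meas : ∀ n : ℕ, 1 ≤ n → Measurable (Y n))
    (hY_indep : iIndepFun (fun n : ℕ => Y (n + 1)) P)
    (hd_pos : ∀ n : ℕ, 1 ≤ n → 0 < d n) (hγ : 0 < γ) {C : ℝ} (hC : 0 < C)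
    (hgrow : ∀ k l : ℕ, 1 ≤ k → k ≤ l → d k / d l ≤ C * ((k : ℝ) / l) ^ γ)
    (hγ' : 0 < γ') (hε0 : 0 < ε) (hε : ε ≤ 1 / 2)
    (hS_int : ∀ n : ℕ, 1 ≤ n → Integrable (partialSum Y n) P)
    (hS_bound : (fun n : ℕ => ∫ ω, |(partialSum Y n ω - m * (n : ℝ)) / d n| ∂P)
      =O[atTop] (fun n : ℕ => Real.exp (γ' * logPlus n ^ (1 - ε))))
    (ht : t ≤ 1) {φ : ℝ → ℝ} (hφ : Measurable φ) (hφ01 : ∀ y, φ y ∈ Set.Icc (0 : ℝ) 1)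
    {K : ℝ} (hK : 0 < K) (hφK : ∀ y z, |φ y - φ z| ≤ K * |y - z|) :
    ∀ᵐ ω ∂P, Tendsto (fun N =>
      logAverage (fun n => φ (normalizedSum Y d m t n ω)) N -
        logAverage (fun n => ∫ ω', φ (normalizedSum Y d m t n ω') ∂P) N) atTop (𝓝 0) := by
  have hX : ∀ n, Measurable (normalizedSum Y d m t n) := fun n =>
    measurable_normalizedSum ht fun i hi _ => hY_meas i hi
  obtain ⟨M, hM, hcov⟩ := exists_abs_covariance_le hY_meas hY_indep hd_pos hγ hC hgrow hγ'
    (hε.trans (by norm_num)) hS_int hS_bound ht hφ hφ01 hK hφK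
  have hg : ∀ n, Measurable fun ω => φ (normalizedSum Y d m t n ω) -
      ∫ ω', φ (normalizedSum Y d m t n ω') ∂P := fun n => (hφ.comp (hX n)).sub_const _
  have hg1 : ∀ n ω, |φ (normalizedSum Y d m t n ω) -
      ∫ ω', φ (normalizedSum Y d m t n ω') ∂P| ≤ 1 := fun n ω => by
    have h1 : ∫ ω', φ (normalizedSum Y d m t n ω') ∂P ≤ 1 := by
      have := integral_mono_of_nonneg (μ := P) (Eventually.of_forall fun ω => (hφ01 _).1)
        (integrable_const (1 : ℝ))
        (Eventually.of_forall fun ω => (hφ01 (normalizedSum Y d m t n ω)).2)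
      simpa using this
    have h0 : 0 ≤ ∫ ω', φ (normalizedSum Y d m t n ω') ∂P := integral_nonneg fun ω => (hφ01 _).1
    have := hφ01 (normalizedSum Y d m t n ω)
    rw [abs_le]
    constructor <;> linarith [this.1, this.2]
  obtain ⟨B, hB, hvar⟩ := exists_integral_sq_logAverage_le hg hg1 hγ hγ' hε hM hcov
  filter_upwards [ae_tendsto_logAverage_zero hg hg1 hε0 hvar] with ω hω
  exact hω.congr fun N => logAverage_sub _ _ N

end

theorem theorem2 {Ω : Type*} [MeasurableSpace Ω] (P : Measure Ω) [IsProbabilityMeasure P]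
    (Y : ℕ → Ω → ℝ) (hY_meas : ∀ n : ℕ, 1 ≤ n → Measurable (Y n))
    (hY_indep : iIndepFun (fun n : ℕ => Y (n + 1)) P)
    (d : ℕ → ℝ) (hd_pos : ∀ n : ℕ, 1 ≤ n → 0 < d n)
    (γ : ℝ) (hγ : 0 < γ) (n₀ : ℕ) (hn₀ : 1 ≤ n₀)
    (hd_growth : ∃ c : ℝ, 0 < c ∧ ∀ k l : ℕ, n₀ ≤ k → k ≤ l →
      c * ((l : ℝ) / (k : ℝ)) ^ γ ≤ d l / d k)
    (m : ℝ) (γ' : ℝ) (hγ'_pos : 0 < γ') (hγ'_lt : γ' < γ) (ε : ℝ) (hε : 0 < ε)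
    (hS_int : ∀ n : ℕ, 1 ≤ n → Integrable (partialSum Y n) P)
    (hS_bound : (fun n : ℕ => ∫ ω, |(partialSum Y n ω - m * (n : ℝ)) / d n| ∂P)
      =O[atTop] (fun n : ℕ => Real.exp (γ' * logPlus n ^ (1 - ε))))
    (t : ℝ) (ht : t ∈ Set.Icc (0 : ℝ) 1)
    (G : Measure ℝ) [IsProbabilityMeasure G] :
    (∀ x : ℝ, ContinuousAt (cdf G) x → ∀ᵐ ω ∂P,
      Tendsto (logAverage fun n : ℕ =>
        Set.indicator {ω' : Ω | normalizedSum Y d m t n ω' ≤ x} (fun _ => (1 : ℝ)) ω)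
        atTop (𝓝 (cdf G x))) ↔
    (∀ x : ℝ, ContinuousAt (cdf G) x →
      Tendsto (logAverage fun n : ℕ => P.real {ω' : Ω | normalizedSum Y d m t n ω' ≤ x})
        atTop (𝓝 (cdf G x))) := by
  obtain ⟨C, hC, hgrow⟩ : ∃ C : ℝ, 0 < C ∧ ∀ k l : ℕ, 1 ≤ k → k ≤ l →
      d k / d l ≤ C * ((k : ℝ) / l) ^ γ := by
    refine exists_growth_from_one hd_pos hn₀ ?_
    obtain ⟨c, hc, h⟩ := hd_growth
    refine ⟨c⁻¹, inv_pos.2 hc, fun k l hk hkl => ?_⟩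
    have hk0 : (0 : ℝ) < k := by exact_mod_cast (by omega : 0 < k)
    have hl0 : (0 : ℝ) < l := by exact_mod_cast (by omega : 0 < l)
    have h1 := inv_anti₀ (by positivity) (h k l hk hkl)
    rwa [mul_inv, ← Real.inv_rpow (by positivity), inv_div, inv_div] at h1
  -- Lowering ε to at most 1/2 only weakens the moment bound, since `logPlus` ≥ 1, and secures the
  -- range needed for the second moment estimate.
  have hS_bound' : (fun n : ℕ => ∫ ω, |(partialSum Y n ω - m * (n : ℝ)) / d n| ∂P)
      =O[atTop] (fun n : ℕ => Real.exp (γ' * logPlus n ^ (1 - min ε (1 / 2)))) := by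
    refine hS_bound.trans (IsBigO.of_bound 1 (Eventually.of_forall fun n => ?_))
    rw [one_mul, Real.norm_eq_abs, Real.norm_eq_abs, Real.abs_exp, Real.abs_exp, Real.exp_le_exp]
    refine mul_le_mul_of_nonneg_left ?_ hγ'_pos.le
    exact Real.rpow_le_rpow_of_exponent_le (one_le_logPlus _)
      (by linarith [min_le_left ε (1 / 2)])
  refine ae_tendsto_logAverage_iff
    (fun n => measurable_normalizedSum ht.2 fun i hi _ => hY_meas i hi) (monotone_cdf G)
    fun a b hab => ?_
  exact ae_tendsto_logAverage_sub_integral hY_meas hY_indep hd_pos hγ hC hgrow hγ'_pos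
    (lt_min hε (by norm_num)) (min_le_right _ _) hS_int hS_bound' ht.2 (measurable_ramp a b)
    (ramp_mem_Icc a b) (one_div_pos.2 (sub_pos.2 hab)) (abs_ramp_sub_ramp_le hab)
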